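/- Let $C(0,1)$ be the real Banach space of continuous functions $[0,1]\to\mathbb{R}$ with the supremum norm. For a real normed space $X$ let $B(X)=\{x\in X:\|x\|\le 1\}$. For $A\subseteq X$ put $d(x,A)=\inf\{\|x-a\|:a\in A\}$, let $\operatorname{Co}(A)$ be the convex hull of $A$, and let $\mathcal{H}$ denote the Hausdorff distance, $\mathcal{H}(A,B)=\sup\{d(x,B),d(y,A):x\in A,\ y\in B\}$. A set $A\subseteq X$ is $\varepsilon$-convex if $d(ta+(1-t)b,A)\le\varepsilon$ for all $a,b\in A$ and $t\in[0,1]$. A function $f:S\to\mathbb{R}$ on a convex set $S\subseteq X$ is $\varepsilon$-convex if $f(tx+(1-t)y)\le tf(x)+(1-t)f(y)+\varepsilon$ for all $x,y\in S$ and $t\in[0,1]$. (1) There is a real Banach space $Y$ such that for every $\varepsilon>0$ there is an $\varepsilon$-convex set $A\subseteq B(Y)$ with $\mathcal{H}(A,\operatorname{Co}(A))=2$. (2) The space $Y=C(0,1)$ has this property: for every $\varepsilon>0$ there is an $\varepsilon$-convex set $A\subseteq B(C(0,1))$ with $\mathcal{H}(A,\operatorname{Co}(A))=2$. (3) For every $\varepsilon>0$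 there is a nonnegative $\varepsilon$-convex $1$-Lipschitz function $f:B(C(0,1))\to\mathbb{R}$ such that $$\sup\{|f(x)-g(x)|:x\in B(C(0,1))\}\ge 1$$ for every convex function $g:B(C(0,1))\to\mathbb{R}$ (the supremum may be $+\infty$). -/

import Mathlib

/-- A set `A` in a real normed space is `ε`-convex if `d(ta + (1 - t)b, A) ≤ ε` for all
`a, b ∈ A` and `t ∈ [0, 1]`. -/
def IsEpsConvexSet {X : Type*} [NormedAddCommGroup X] [NormedSpace ℝ X] (ε : ℝ) (A : Set X) :
    Prop :=
  ∀ a ∈ A, ∀ b ∈ A, ∀ t ∈ Set.Icc (0 : ℝ) 1, Metric.infDist (t • a + (1 - t) • b) A ≤ ε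

/-- A real function `f` is `ε`-convex on the convex set `S` if
`f (tx + (1 - t)y) ≤ t f x + (1 - t) f y + ε` for all `x, y ∈ S` and `t ∈ [0, 1]`. -/
def IsEpsConvexOn {X : Type*} [NormedAddCommGroup X] [NormedSpace ℝ X] (ε : ℝ) (S : Set X)
    (f : X → ℝ) : Prop :=
  Convex ℝ S ∧ ∀ x ∈ S, ∀ y ∈ S, ∀ t ∈ Set.Icc (0 : ℝ) 1,
    f (t • x + (1 - t) • y) ≤ t * f x + (1 - t) * f y + ε

/-! Take functions `x i` in the unit ball that realise every finite sign pattern, and measure a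
convex combination of them by the entropy of its weights. Entropy vanishes at the vertices and is
convex up to `log 2` (`finEntropy_mix_le`). Bounded entropy puts most of the weight on boundedly
many large atoms; at a point where exactly those `x i` are `-1`, the combination is near `-1`, while
a long uniform average is near `1` (`exists_average_far`). The combinations of entropy at most a
large constant thus form an almost convex set nearly `2` away from some averages. Likewise the
infimal convolution of the norm with `ε` times entropy is zero at each `x i` but almost `2` at some
average, which no convex function can follow with uniform error below `1`. -/

/-- There are continuous functions on the unit interval with values in `[-1, 1]` that jointly
attain every pattern of signs. -/
theorem exists_continuousMap_sign_patterns :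
    ∃ x : ℕ → C(unitInterval, ℝ), (∀ i, ‖x i‖ ≤ 1) ∧
      ∀ S : Finset ℕ, ∃ t, ∀ i, x i t = if i ∈ S then -1 else 1 := by
  -- On a copy of the Cantor set the signs are coordinate functions; Tietze extends them to the
  -- interval within `[-1, 1]`.
  let e : (ℕ → Bool) → unitInterval := fun b =>
    ⟨(cantorSetHomeomorphNatToBool.symm b : ℝ), cantorSet_subset_unitInterval (Subtype.coe_prop _)⟩
  have he : Topology.IsClosedEmbedding e := by
    refine Continuous.isClosedEmbedding (by fun_prop) fun a b hab => ?_
    have h := congrArg Subtype.val hab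
    exact cantorSetHomeomorphNatToBool.symm.injective (Subtype.ext h)
  have hx : ∀ i : ℕ, ∃ g : C(unitInterval, ℝ), (∀ t, g t ∈ Set.Icc (-1 : ℝ) 1) ∧
      ∀ b : ℕ → Bool, g (e b) = if b i then -1 else 1 := fun i => by
    have hc : Continuous fun b : ℕ → Bool => if b i then (-1 : ℝ) else 1 :=
      (continuous_of_discreteTopology (f := fun c : Bool => if c then (-1 : ℝ) else 1)).comp
        (continuous_apply i)
    obtain ⟨g, hg, hge⟩ := ContinuousMap.exists_extension_forall_mem_of_isClosedEmbedding
      (⟨_, hc⟩ : C(ℕ → Bool, ℝ)) (t := Set.Icc (-1 : ℝ) 1)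
      (fun b => by
        simp only [ContinuousMap.coe_mk]
        split_ifs <;> norm_num) ⟨0, by norm_num⟩ he
    exact ⟨g, hg, fun b => congrFun hge b⟩
  choose x hx1 hx2 using hx
  refine ⟨x, fun i => ?_, fun S => ⟨e fun i => decide (i ∈ S), fun i => by simp [hx2]⟩⟩
  exact (ContinuousMap.norm_le _ zero_le_one).2 fun t => abs_le.2 (hx1 i t)

/-! ### Entropy of finitely supported weights -/

/-- The finitely supported probability weights on `ℕ`. -/
def finProb : Set (ℕ →₀ ℝ) := {w | (∀ i, 0 ≤ w i) ∧ w.sum (fun _ a => a) = 1}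

/-- The Shannon entropy of finitely supported weights. -/
noncomputable def finEntropy (w : ℕ →₀ ℝ) : ℝ := w.sum fun _ a => Real.negMulLog a

theorem single_mem_finProb (i : ℕ) : Finsupp.single i (1 : ℝ) ∈ finProb := by
  refine ⟨fun j => ?_, by simp⟩
  rw [Finsupp.single_apply]
  split_ifs <;> norm_num

theorem finEntropy_single (i : ℕ) : finEntropy (Finsupp.single i 1) = 0 := by
  simp [finEntropy]

theorem finProb_le_one {w : ℕ →₀ ℝ} (hw : w ∈ finProb) (i : ℕ) : w i ≤ 1 := by
  by_cases hi : i ∈ w.support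
  · exact hw.2 ▸ Finset.single_le_sum (f := fun i => w i) (fun j _ => hw.1 j) hi
  · simp [Finsupp.notMem_support_iff.1 hi]

theorem finEntropy_nonneg {w : ℕ →₀ ℝ} (hw : w ∈ finProb) : 0 ≤ finEntropy w :=
  Finset.sum_nonneg fun i _ => Real.negMulLog_nonneg (hw.1 i) (finProb_le_one hw i)

theorem convex_finProb : Convex ℝ finProb := by
  intro v hv w hw a b ha hb hab
  refine ⟨fun i => ?_, ?_⟩
  · have := hv.1 i
    have := hw.1 i
    simp only [Finsupp.add_apply, Finsupp.smul_apply, smul_eq_mul]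
    positivity
  · rw [Finsupp.sum_add_index' (by simp) (by simp), Finsupp.sum_smul_index (by simp),
      Finsupp.sum_smul_index (by simp), ← Finsupp.mul_sum, ← Finsupp.mul_sum, hv.2, hw.2]
    linarith

/-- `negMulLog` is subadditive on the nonnegative reals. -/
theorem negMulLog_add_le {a b : ℝ} (ha : 0 ≤ a) (hb : 0 ≤ b) :
    Real.negMulLog (a + b) ≤ Real.negMulLog a + Real.negMulLog b := by
  rcases ha.eq_or_lt with rfl | ha
  · simp
  rcases hb.eq_or_lt with rfl | hb
  · simp
  have h1 := Real.log_le_log ha (by linarith : a ≤ a + b)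
  have h2 := Real.log_le_log hb (by linarith : b ≤ a + b)
  have h3 := mul_le_mul_of_nonneg_left h1 ha.le
  have h4 := mul_le_mul_of_nonneg_left h2 hb.le
  simp only [Real.negMulLog]
  linarith

/-- Entropy is convex up to the additive constant `log 2`. -/
theorem finEntropy_mix_le {v w : ℕ →₀ ℝ} (hv : v ∈ finProb) (hw : w ∈ finProb) {t : ℝ}
    (ht : t ∈ Set.Icc (0 : ℝ) 1) :
    finEntropy (t • v + (1 - t) • w) ≤
      t * finEntropy v + (1 - t) * finEntropy w + Real.log 2 := by
  have ht' : 0 ≤ 1 - t := sub_nonneg.2 ht.2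
  set s := v.support ∪ w.support with hs
  have hmix : (t • v + (1 - t) • w).support ⊆ s := fun i hi => by
    contrapose! hi
    simp only [hs, Finset.mem_union, Finsupp.mem_support_iff, not_or, not_not] at hi
    simp [hi]
  -- Summed over `i`, the last bracket becomes the binary entropy of `t`, which is at most `log 2`.
  have key : ∀ i, Real.negMulLog ((t • v + (1 - t) • w) i) ≤
      t * Real.negMulLog (v i) + (1 - t) * Real.negMulLog (w i) +
        (v i * Real.negMulLog t + w i * Real.negMulLog (1 - t)) := fun i => by
    simp only [Finsupp.add_apply, Finsupp.smul_apply, smul_eq_mul]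
    refine (negMulLog_add_le (mul_nonneg ht.1 (hv.1 i)) (mul_nonneg ht' (hw.1 i))).trans_eq ?_
    rw [Real.negMulLog_mul, Real.negMulLog_mul]
    ring
  have hv2 := hv.2
  have hw2 := hw.2
  rw [Finsupp.sum_of_support_subset v Finset.subset_union_left _ (by simp)] at hv2
  rw [Finsupp.sum_of_support_subset w Finset.subset_union_right _ (by simp)] at hw2
  have hbin := Real.binEntropy_le_log_two (p := t)
  rw [Real.binEntropy_eq_negMulLog_add_negMulLog_one_sub] at hbin
  unfold finEntropy
  rw [Finsupp.sum_of_support_subset _ hmix _ (by simp),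
    Finsupp.sum_of_support_subset v Finset.subset_union_left _ (by simp),
    Finsupp.sum_of_support_subset w Finset.subset_union_right _ (by simp)]
  refine (Finset.sum_le_sum fun i _ => key i).trans ?_
  rw [Finset.sum_add_distrib, Finset.sum_add_distrib, Finset.sum_add_distrib, ← Finset.mul_sum,
    ← Finset.mul_sum, ← Finset.sum_mul, ← Finset.sum_mul, hv2, hw2]
  linarith

/-- The weight that a probability of entropy at most `M` gives to its atoms below
`exp (-L)` is at most `M / L`. -/
theorem sum_small_atoms_mul_le {w : ℕ →₀ ℝ} (hw : w ∈ finProb) (L : ℝ) :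
    (∑ i ∈ w.support, w i * if Real.exp (-L) ≤ w i then 0 else 1) * L ≤ finEntropy w := by
  rw [Finset.sum_mul]
  refine Finset.sum_le_sum fun i hi => ?_
  split_ifs with h
  · simpa using Real.negMulLog_nonneg (hw.1 i) (finProb_le_one hw i)
  · have h0 : 0 < w i := (hw.1 i).lt_of_ne' (Finsupp.mem_support_iff.1 hi)
    have h1 : Real.log (w i) ≤ -L := (Real.log_le_iff_le_exp h0).2 (not_le.1 h).le
    have h2 := mul_le_mul_of_nonneg_left h1 (hw.1 i)
    simp only [Real.negMulLog]
    linarith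

theorem linearCombination_mem_convexHull {E : Type*} [NormedAddCommGroup E] [NormedSpace ℝ E]
    (x : ℕ → E) {w : ℕ →₀ ℝ} (hw : w ∈ finProb) :
    Finsupp.linearCombination ℝ x w ∈ convexHull ℝ (Set.range x) :=
  (convex_convexHull ℝ _).sum_mem (fun i _ => hw.1 i) hw.2 fun i _ =>
    subset_convexHull ℝ _ ⟨i, rfl⟩

theorem norm_linearCombination_le_one {E : Type*} [NormedAddCommGroup E] [NormedSpace ℝ E]
    {x : ℕ → E} (hx : ∀ i, ‖x i‖ ≤ 1) {w : ℕ →₀ ℝ} (hw : w ∈ finProb) :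
    ‖Finsupp.linearCombination ℝ x w‖ ≤ 1 := by
  have h : convexHull ℝ (Set.range x) ⊆ Metric.closedBall 0 1 :=
    convexHull_min (by rintro _ ⟨i, rfl⟩; simpa using hx i) (convex_closedBall _ _)
  simpa using h (linearCombination_mem_convexHull x hw)

/-- Averages of many members of a family with all sign patterns are almost at distance `2` from
all combinations of bounded entropy. -/
theorem exists_average_far {x : ℕ → C(unitInterval, ℝ)}
    (hx : ∀ S : Finset ℕ, ∃ t, ∀ i, x i t = if i ∈ S then -1 else 1)
    {M η : ℝ} (hM : 0 < M) (hη : 0 < η) :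
    ∃ c ∈ convexHull ℝ (Set.range x), ∀ w ∈ finProb, finEntropy w ≤ M →
      2 - η ≤ ‖c - Finsupp.linearCombination ℝ x w‖ := by
  -- Atoms below `δ` then carry weight at most `η / 4`. At most `1 / δ` atoms are larger, so
  -- flipping their signs changes a uniform average of `n ≥ 4 / (δ * η)` terms by at most `η / 2`.
  set L : ℝ := 4 * M / η with hL
  have hL0 : 0 < L := by positivity
  set δ : ℝ := Real.exp (-L) with hδ
  have hδ0 : 0 < δ := Real.exp_pos _
  obtain ⟨n, hn⟩ := exists_nat_ge (4 / (δ * η))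
  have hn0 : (0 : ℝ) < n := lt_of_lt_of_le (by positivity) hn
  refine ⟨∑ i ∈ Finset.range n, (n : ℝ)⁻¹ • x i, ?_, fun w hw hwM => ?_⟩
  · refine (convex_convexHull ℝ _).sum_mem (fun _ _ => by positivity) ?_ fun i _ =>
      subset_convexHull ℝ _ ⟨i, rfl⟩
    simp [hn0.ne']
  set S := w.support.filter fun i => δ ≤ w i with hS
  obtain ⟨t, ht⟩ := hx S
  have hcard : (S.card : ℝ) * δ ≤ 1 := by
    rw [← nsmul_eq_mul, ← hw.2]
    refine (Finset.card_nsmul_le_sum S (fun i => w i) δ fun i hi => (Finset.mem_filter.1 hi).2).trans ?_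
    exact Finset.sum_le_sum_of_subset_of_nonneg (Finset.filter_subset _ _) fun i _ _ => hw.1 i
  have hc : 1 - η / 2 ≤ (∑ i ∈ Finset.range n, (n : ℝ)⁻¹ • x i) t := by
    have h1 : (∑ i ∈ Finset.range n, (n : ℝ)⁻¹ • x i) t =
        1 - 2 * (n : ℝ)⁻¹ * ((Finset.range n).filter (· ∈ S)).card := by
      have h2 : ∀ i, x i t = 1 - 2 * if i ∈ S then (1 : ℝ) else 0 := fun i => by
        rw [ht]; split_ifs <;> norm_num
      simp only [ContinuousMap.sum_apply, ContinuousMap.smul_apply, smul_eq_mul, h2]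
      rw [← Finset.mul_sum, Finset.sum_sub_distrib, ← Finset.mul_sum, Finset.sum_boole]
      simp only [Finset.sum_const, Finset.card_range, nsmul_eq_mul, mul_one]
      field_simp
    have h3 : (((Finset.range n).filter (· ∈ S)).card : ℝ) ≤ S.card := by
      exact_mod_cast Finset.card_le_card fun i hi => (Finset.mem_filter.1 hi).2
    have h4 : 2 * (n : ℝ)⁻¹ * S.card ≤ η / 2 := by
      rw [div_le_iff₀ (by positivity)] at hn
      rw [mul_right_comm, ← div_eq_mul_inv, div_le_iff₀ hn0]
      refine le_of_mul_le_mul_right ?_ hδ0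
      nlinarith
    have h5 := mul_le_mul_of_nonneg_left h3 (by positivity : 0 ≤ 2 * (n : ℝ)⁻¹)
    linarith
  have hwt : (Finsupp.linearCombination ℝ x w) t ≤ -1 + η / 2 := by
    have h1 : (Finsupp.linearCombination ℝ x w) t =
        -1 + 2 * ∑ i ∈ w.support, w i * if δ ≤ w i then 0 else 1 := by
      have hw2 : (-1 : ℝ) = -∑ i ∈ w.support, w i := congrArg Neg.neg hw.2.symm
      rw [Finsupp.linearCombination_apply, Finsupp.sum, ContinuousMap.sum_apply, hw2,
        Finset.mul_sum, ← Finset.sum_neg_distrib, ← Finset.sum_add_distrib]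
      refine Finset.sum_congr rfl fun i hi => ?_
      have : i ∈ S ↔ δ ≤ w i := by simp only [hS, Finset.mem_filter, hi, true_and]
      simp only [ContinuousMap.smul_apply, smul_eq_mul, ht, this]
      split_ifs <;> ring
    have h2 := (sum_small_atoms_mul_le hw L).trans hwM
    rw [← le_div_iff₀ hL0] at h2
    have h3 : M / L = η / 4 := by rw [hL]; field_simp
    rw [h1]
    linarith
  have := (le_abs_self _).trans
    (ContinuousMap.norm_coe_le_norm (∑ i ∈ Finset.range n, (n : ℝ)⁻¹ • x i -
      Finsupp.linearCombination ℝ x w) t)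
  rw [ContinuousMap.sub_apply] at this
  linarith

/-! ### The almost convex set -/

/-- The combinations of entropy at most `2 / s` form an approximately convex set. -/
theorem isEpsConvexSet_image_finEntropy_le {E : Type*} [NormedAddCommGroup E] [NormedSpace ℝ E]
    {x : ℕ → E} (hx : ∀ i, ‖x i‖ ≤ 1) {s : ℝ} (hs : 0 < s) (hs1 : s ≤ 1) :
    IsEpsConvexSet (2 * s)
      (Finsupp.linearCombination ℝ x '' {w | w ∈ finProb ∧ finEntropy w ≤ 2 / s}) := by
  rintro _ ⟨v, ⟨hv, hvM⟩, rfl⟩ _ ⟨w, ⟨hw, hwM⟩, rfl⟩ t ht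
  set u := t • v + (1 - t) • w with hu
  have huP : u ∈ finProb := convex_finProb hv hw ht.1 (sub_nonneg.2 ht.2) (by ring)
  have hlog : Real.log 2 ≤ 1 := Real.log_two_lt_d9.le.trans (by norm_num)
  have hue : finEntropy u ≤ 2 / s + 1 := by
    have h1 := finEntropy_mix_le hv hw ht
    have h2 := mul_le_mul_of_nonneg_left hvM ht.1
    have h3 := mul_le_mul_of_nonneg_left hwM (sub_nonneg.2 ht.2)
    linarith
  -- Pulling `u` towards a vertex by the fraction `s` moves its image by at most `2 * s` and
  -- restores the bound: `(1 - s) * (2 / s + 1) + log 2 ≤ 2 / s - s`.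
  have h0 := single_mem_finProb 0
  have hzP := convex_finProb h0 huP hs.le (sub_nonneg.2 hs1) (by ring)
  have hze := finEntropy_mix_le h0 huP ⟨hs.le, hs1⟩
  rw [finEntropy_single] at hze
  have h1 := mul_le_mul_of_nonneg_left hue (sub_nonneg.2 hs1)
  have h2 : s * (2 / s) = 2 := by field_simp
  have hmem : s • Finsupp.single 0 1 + (1 - s) • u ∈
      {w | w ∈ finProb ∧ finEntropy w ≤ 2 / s} := ⟨hzP, by linarith⟩
  refine (Metric.infDist_le_dist_of_mem
    (Set.mem_image_of_mem (Finsupp.linearCombination ℝ x) hmem)).trans ?_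
  · rw [← map_smul, ← map_smul, ← map_add, ← hu, dist_eq_norm, ← map_sub,
      show u - (s • Finsupp.single 0 1 + (1 - s) • u) = s • (u - Finsupp.single 0 1) by module,
      map_smul, norm_smul, Real.norm_of_nonneg hs.le, map_sub]
    have h3 := norm_sub_le (Finsupp.linearCombination ℝ x u)
      (Finsupp.linearCombination ℝ x (Finsupp.single 0 1))
    have h4 := norm_linearCombination_le_one hx huP
    have h5 := norm_linearCombination_le_one hx h0
    nlinarith

theorem exists_isEpsConvexSet_hausdorffEDist_convexHull_eq_two {ε : ℝ} (hε : 0 < ε) :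
    ∃ A : Set C(unitInterval, ℝ), A ⊆ Metric.closedBall 0 1 ∧
      IsEpsConvexSet ε A ∧ Metric.hausdorffEDist A (convexHull ℝ A) = 2 := by
  obtain ⟨x, hx, hsign⟩ := exists_continuousMap_sign_patterns
  set s := min (ε / 2) 1 with hs
  have hs0 : 0 < s := lt_min (by positivity) one_pos
  set A := Finsupp.linearCombination ℝ x '' {w | w ∈ finProb ∧ finEntropy w ≤ 2 / s} with hA
  have hxA : Set.range x ⊆ A := by
    rintro _ ⟨i, rfl⟩
    exact ⟨Finsupp.single i 1, ⟨single_mem_finProb i, by rw [finEntropy_single]; positivity⟩,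
      by simp⟩
  have hAB : A ⊆ Metric.closedBall 0 1 := by
    rintro _ ⟨w, hw, rfl⟩
    simpa using norm_linearCombination_le_one hx hw.1
  have hCB : convexHull ℝ A ⊆ Metric.closedBall 0 1 := convexHull_min hAB (convex_closedBall _ _)
  have hle : ∀ a ∈ Metric.closedBall (0 : C(unitInterval, ℝ)) 1,
      ∀ b ∈ Metric.closedBall (0 : C(unitInterval, ℝ)) 1, edist a b ≤ 2 := fun a ha b hb => by
    rw [edist_dist, ← ENNReal.ofReal_ofNat]
    refine ENNReal.ofReal_le_ofReal ((dist_triangle_right a b 0).trans ?_)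
    rw [Metric.mem_closedBall] at ha hb
    linarith
  refine ⟨A, hAB, fun a ha b hb t ht => ?_, le_antisymm ?_ ?_⟩
  · exact (isEpsConvexSet_image_finEntropy_le hx hs0 (min_le_right _ _) a ha b hb t ht).trans
      (by linarith [min_le_left (ε / 2) 1])
  · have h0 := hxA ⟨0, rfl⟩
    exact Metric.hausdorffEDist_le_of_mem_edist
      (fun a ha => ⟨_, subset_convexHull ℝ A ha, by simp⟩)
      fun a ha => ⟨_, h0, hle _ (hCB ha) _ (hAB h0)⟩
  -- The distance `2` is reached only as a supremum: each `q < 2` is beaten by an average with `η =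
  -- 2 - q`.
  · refine le_of_forall_lt fun r hr => ?_
    obtain ⟨q, hrq, hq⟩ := ENNReal.lt_iff_exists_nnreal_btwn.1 hr
    have hq2 : (q : ℝ) < 2 := by exact_mod_cast hq
    obtain ⟨c, hc, hfar⟩ := exists_average_far hsign (M := 2 / s) (η := 2 - q) (by positivity)
      (sub_pos.2 hq2)
    rw [Metric.hausdorffEDist_comm]
    refine hrq.trans_le (le_trans ?_
      (Metric.infEDist_le_hausdorffEDist_of_mem (convexHull_mono hxA hc)))
    refine Metric.le_infEDist.2 ?_
    rintro _ ⟨w, hw, rfl⟩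
    rw [edist_dist, dist_eq_norm, ← ENNReal.ofReal_coe_nnreal]
    exact ENNReal.ofReal_le_ofReal (by linarith [hfar w hw.1 hw.2])

/-! ### The almost convex function -/

/-- The infimal convolution of the norm with the multiple `ε` of the entropy. -/
noncomputable def entropyConvolution {E : Type*} [NormedAddCommGroup E] [NormedSpace ℝ E]
    (ε : ℝ) (x : ℕ → E) (z : E) : ℝ :=
  ⨅ w : finProb, (ε * finEntropy w + ‖z - Finsupp.linearCombination ℝ x (w : ℕ →₀ ℝ)‖)

section entropyConvolution

variable {E : Type*} [NormedAddCommGroup E] [NormedSpace ℝ E] {ε : ℝ} {x : ℕ → E}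

instance : Nonempty finProb := ⟨⟨_, single_mem_finProb 0⟩⟩

theorem entropyConvolution_nonneg (hε : 0 ≤ ε) (z : E) : 0 ≤ entropyConvolution ε x z :=
  le_ciInf fun w => add_nonneg (mul_nonneg hε (finEntropy_nonneg w.2)) (norm_nonneg _)

theorem entropyConvolution_le (hε : 0 ≤ ε) (z : E) {w : ℕ →₀ ℝ} (hw : w ∈ finProb) :
    entropyConvolution ε x z ≤ ε * finEntropy w + ‖z - Finsupp.linearCombination ℝ x w‖ :=
  ciInf_le (f := fun w : finProb =>
      ε * finEntropy w + ‖z - Finsupp.linearCombination ℝ x (w : ℕ →₀ ℝ)‖)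
    ⟨0, by
      rintro _ ⟨w, rfl⟩
      exact add_nonneg (mul_nonneg hε (finEntropy_nonneg w.2)) (norm_nonneg _)⟩ ⟨w, hw⟩

theorem exists_lt_entropyConvolution_add (z : E) {r : ℝ} (hr : 0 < r) :
    ∃ w ∈ finProb, ε * finEntropy w + ‖z - Finsupp.linearCombination ℝ x w‖ <
      entropyConvolution ε x z + r := by
  obtain ⟨w, hw⟩ := exists_lt_of_ciInf_lt (lt_add_of_pos_right (entropyConvolution ε x z) hr)
  exact ⟨w, w.2, hw⟩

theorem entropyConvolution_self (hε : 0 ≤ ε) (i : ℕ) : entropyConvolution ε x (x i) = 0 := by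
  refine le_antisymm ?_ (entropyConvolution_nonneg hε _)
  simpa [finEntropy_single] using entropyConvolution_le (x := x) hε (x i) (single_mem_finProb i)

theorem lipschitzWith_entropyConvolution (hε : 0 ≤ ε) :
    LipschitzWith 1 (entropyConvolution ε x) := by
  refine LipschitzWith.of_le_add fun y z => le_of_forall_pos_lt_add fun r hr => ?_
  obtain ⟨w, hw, h⟩ := exists_lt_entropyConvolution_add (ε := ε) (x := x) z hr
  have h1 := entropyConvolution_le (x := x) hε y hw
  have h2 := norm_sub_le_norm_sub_add_norm_sub y z (Finsupp.linearCombination ℝ x w)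
  rw [dist_eq_norm]
  linarith

/-- Mixing near-minimisers for the two endpoints costs nothing in the norm term, by convexity, and
at most `ε * log 2` in the entropy term. -/
theorem isEpsConvexOn_entropyConvolution (hε : 0 ≤ ε) {S : Set E} (hS : Convex ℝ S) :
    IsEpsConvexOn ε S (entropyConvolution ε x) := by
  refine ⟨hS, fun y _ z _ t ht => le_of_forall_pos_lt_add fun r hr => ?_⟩
  have ht' : 0 ≤ 1 - t := sub_nonneg.2 ht.2
  obtain ⟨v, hv, h1⟩ := exists_lt_entropyConvolution_add (ε := ε) (x := x) y (half_pos hr)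
  obtain ⟨w, hw, h2⟩ := exists_lt_entropyConvolution_add (ε := ε) (x := x) z (half_pos hr)
  refine (entropyConvolution_le hε _
    (convex_finProb hv hw ht.1 ht' (by ring))).trans_lt ?_
  have h3 := mul_le_mul_of_nonneg_left (finEntropy_mix_le hv hw ht) hε
  have h4 : ‖t • y + (1 - t) • z - Finsupp.linearCombination ℝ x (t • v + (1 - t) • w)‖ ≤
      t * ‖y - Finsupp.linearCombination ℝ x v‖ +
        (1 - t) * ‖z - Finsupp.linearCombination ℝ x w‖ := by
    rw [map_add, map_smul, map_smul, add_sub_add_comm, ← smul_sub, ← smul_sub]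
    refine (norm_add_le _ _).trans_eq ?_
    rw [norm_smul, norm_smul, Real.norm_of_nonneg ht.1, Real.norm_of_nonneg ht']
  have h5 := mul_le_mul_of_nonneg_left h1.le ht.1
  have h6 := mul_le_mul_of_nonneg_left h2.le ht'
  have h7 : ε * Real.log 2 ≤ ε :=
    mul_le_of_le_one_right hε (Real.log_two_lt_d9.le.trans (by norm_num))
  linarith

end entropyConvolution

theorem exists_isEpsConvexOn_far_from_convex {ε : ℝ} (hε : 0 < ε) :
    ∃ f : C(unitInterval, ℝ) → ℝ,
      (∀ x ∈ Metric.closedBall (0 : C(unitInterval, ℝ)) 1, 0 ≤ f x) ∧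
      IsEpsConvexOn ε (Metric.closedBall 0 1) f ∧
      LipschitzOnWith 1 f (Metric.closedBall 0 1) ∧
      ∀ g : C(unitInterval, ℝ) → ℝ, ConvexOn ℝ (Metric.closedBall 0 1) g →
        1 ≤ ⨆ x ∈ Metric.closedBall (0 : C(unitInterval, ℝ)) 1, ENNReal.ofReal |f x - g x| := by
  obtain ⟨x, hx, hsign⟩ := exists_continuousMap_sign_patterns
  refine ⟨entropyConvolution ε x, fun z _ => entropyConvolution_nonneg hε.le z,
    isEpsConvexOn_entropyConvolution hε.le (convex_closedBall _ _),
    (lipschitzWith_entropyConvolution hε.le).lipschitzOnWith, fun g hg => ?_⟩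
  by_contra! hlt
  obtain ⟨q, hsup, hq⟩ := ENNReal.lt_iff_exists_nnreal_btwn.1 hlt
  have hq1 : (q : ℝ) < 1 := by exact_mod_cast hq
  have hclose : ∀ z ∈ Metric.closedBall (0 : C(unitInterval, ℝ)) 1,
      |entropyConvolution ε x z - g z| ≤ q := fun z hz => by
    have h := (le_iSup₂ (f := fun z (_ : z ∈ Metric.closedBall (0 : C(unitInterval, ℝ)) 1) =>
      ENNReal.ofReal |entropyConvolution ε x z - g z|) z hz).trans hsup.le
    rw [← ENNReal.ofReal_coe_nnreal] at h
    exact (ENNReal.ofReal_le_ofReal_iff q.2).1 h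
  have hxB : Set.range x ⊆ Metric.closedBall 0 1 := by
    rintro _ ⟨i, rfl⟩
    simpa using hx i
  -- Weights of entropy above `2 / ε` already pay `2` through the entropy term; the others pay `1 +
  -- q` through the norm.
  obtain ⟨c, hc, hfar⟩ := exists_average_far hsign (M := 2 / ε) (η := 1 - q) (by positivity)
    (sub_pos.2 hq1)
  have hcB := convexHull_min hxB (convex_closedBall _ _) hc
  have hfc : 2 - (1 - q) ≤ entropyConvolution ε x c := by
    refine le_ciInf fun w => ?_
    rcases le_total (finEntropy w) (2 / ε) with h | h
    · have h1 := mul_nonneg hε.le (finEntropy_nonneg w.2)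
      linarith [hfar w w.2 h]
    · rw [div_le_iff₀' hε] at h
      linarith [norm_nonneg (c - Finsupp.linearCombination ℝ x (w : ℕ →₀ ℝ))]
  -- By the maximum principle `g c ≤ g (x i)` for some `i`, yet `g c ≥ (1 + q) - q = 1` and `g (x i)
  -- ≤ q < 1`.
  obtain ⟨_, ⟨i, rfl⟩, hgi⟩ := (hg.subset (convexHull_min hxB (convex_closedBall _ _))
    (convex_convexHull ℝ _)).exists_ge_of_mem_convexHull (subset_convexHull ℝ _) hc
  have h1 := abs_le.1 (hclose c hcB)
  have h2 := abs_le.1 (hclose _ (hxB ⟨i, rfl⟩))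
  rw [entropyConvolution_self hε.le] at h2
  linarith [h1.2, h2.1]

theorem corollary6 :
    (∃ (Y : Type) (_ : NormedAddCommGroup Y) (_ : NormedSpace ℝ Y) (_ : CompleteSpace Y),
      ∀ ε : ℝ, 0 < ε → ∃ A : Set Y, A ⊆ Metric.closedBall 0 1 ∧ IsEpsConvexSet ε A ∧
        Metric.hausdorffEDist A (convexHull ℝ A) = 2) ∧
    (∀ ε : ℝ, 0 < ε → ∃ A : Set C(unitInterval, ℝ), A ⊆ Metric.closedBall 0 1 ∧
      IsEpsConvexSet ε A ∧ Metric.hausdorffEDist A (convexHull ℝ A) = 2) ∧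
    (∀ ε : ℝ, 0 < ε → ∃ f : C(unitInterval, ℝ) → ℝ,
      (∀ x ∈ Metric.closedBall (0 : C(unitInterval, ℝ)) 1, 0 ≤ f x) ∧
      IsEpsConvexOn ε (Metric.closedBall 0 1) f ∧
      LipschitzOnWith 1 f (Metric.closedBall 0 1) ∧
      ∀ g : C(unitInterval, ℝ) → ℝ, ConvexOn ℝ (Metric.closedBall 0 1) g →
        1 ≤ ⨆ x ∈ Metric.closedBall (0 : C(unitInterval, ℝ)) 1, ENNReal.ofReal |f x - g x|) := by
  have h := fun ε hε => exists_isEpsConvexSet_hausdorffEDist_convexHull_eq_two (ε := ε) hε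
  exact ⟨⟨C(unitInterval, ℝ), inferInstance, inferInstance, inferInstance, h⟩, h,
    fun ε hε => exists_isEpsConvexOn_far_from_convex hε⟩
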